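/- Let $\mathbb N$ be the set of nonnegative integers and let $\mathbf F=\bigcup_{k\ge 1}\mathcal P(\mathbb N^k)$ be the family of all point sets over $\mathbb N$; Cartesian products of point sets are identified with concatenations, $A\times B=\{(a_1,\dots,a_k,b_1,\dots,b_h)\mid (a_1,\dots,a_k)\in A,\ (b_1,\dots,b_h)\in B\}$. An *equinumerosity* is an equivalence relation $\approx$ on $\mathbf F$ such that for all $A,A',B,B'\in\mathbf F$: (E1) $A\approx B$ if and only if $A\setminus B\approx B\setminus A$; (E2) exactly one of the following holds: (a) $A\approx B$; (b) $A'\approx B$ for some proper subset $A'\subset A$; (c) $A\approx B'$ for some proper subset $B'\subset B$; (E3) $A\times\{P\}\approx\{P\}\times A\approx A$ for every point $P\in\bigcup_{k\ge1}\mathbb N^k$; (E4) if $A\approx A'$ and $B\approx B'$, then $A\times B\approx A'\times B'$. For $X\subseteq\mathbb N^k$ put $X_n=\{x\in X\mid x_i\le n\text{ for }i=1,\dots,k\}$. The equinumerosity is *asymptotic* if: (E0) whenever $|X_n|\le|Y_n|$ for all $n\in\mathbb N$, there is $Z\subseteq Y$ with $X\approx Z$. Let $\mathfrak N=\mathbf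 F/{\approx}$ be the set of numerosities and $\mathfrak n(X)$ the class of $X$. The set $\mathfrak N$ carries the sum, product and order given by $\mathfrak n(A)+\mathfrak n(B)=\mathfrak n(A\cup B)$ for disjoint $A,B$ of the same dimension, $\mathfrak n(A)\cdot\mathfrak n(B)=\mathfrak n(A\times B)$, and $\mathfrak n(A)<\mathfrak n(B)$ if and only if $A\approx B'$ for some proper subset $B'\subset B$; its zero is $\mathfrak n(\emptyset)$ and its unit is the common numerosity of all singletons. A nonprincipal ultrafilter $\mathcal U$ on $\mathbb N$ is *quasi-selective* if for every $f:\mathbb N\to\mathbb N$ with $f(n)\le n$ for all $n$ there is a nondecreasing $g:\mathbb N\to\mathbb N$ with $\{n\mid f(n)=g(n)\}\in\mathcal U$. A sequence $f:\mathbb N\to\mathbb N$ is *polynomially bounded* if there are $k,m$ with $f(n)<n^k$ for all $n>m$. **Corollary.** There is a one-to-one correspondence between asymptotic equinumerosity relations $\approx$ on $\mathbf F$ and quasi-selective ultrafilters $\mathcal U$ on $\mathbb N$ such that, whenever $\approx$ corresponds to $\mathcal U$, $$X\approx Y\iff\{n\in\mathbb N\mid |X_n|=|Y_n|\}\in\mathcal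 U\qquad\text{for all }X,Y\in\mathbf F,\tag{$\sharp$}$$ and it is the only one-to-one correspondence with this property. Moreover, whenever an asymptotic equinumerosity $\approx$ and a quasi-selective ultrafilter $\mathcal U$ satisfy $(\sharp)$, the set $\mathbb P_{\mathcal U}$ of the classes of all polynomially bounded sequences is an initial segment of the ultrapower $\mathbb N^{\mathbb N}/\mathcal U$, and the map $$\varphi:\mathfrak n(X)\mapsto[\langle|X_n|\rangle_{n\in\mathbb N}]_{\mathcal U}$$ is a well-defined isomorphism of ordered semirings from $\mathfrak N$ onto $\mathbb P_{\mathcal U}$. In particular, asymptotic equinumerosities exist if and only if quasi-selective ultrafilters exist. -/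

import Mathlib

open Filter

/-- A point set over `ℕ`: a subset of `ℕ ^ k` for some `k ≥ 1`. A `k`-tuple is a list of length `k`,
so that tuples of tuples are identified with their concatenations. There is only one empty point
set, common to all dimensions. -/
@[ext]
structure PointSet where
  carrier : Set (List ℕ)
  homogeneous : ∃ k : ℕ, 0 < k ∧ ∀ x ∈ carrier, x.length = k

namespace PointSet

/-- A subset of a point set, as a point set. -/
def restrict (A : PointSet) (S : Set (List ℕ)) (h : S ⊆ A.carrier) : PointSet where
  carrier := S
  homogeneous := A.homogeneous.imp fun _ hk => ⟨hk.1, fun x hx => hk.2 x (h hx)⟩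

/-- The set difference `A \ B`. -/
def diff (A B : PointSet) : PointSet :=
  A.restrict (A.carrier \ B.carrier) Set.sdiff_subset

/-- The empty point set. -/
def empty : PointSet := ⟨∅, 1, Nat.one_pos, fun _ hx => hx.elim⟩

/-- The singleton `{P}` of a point `P` (a tuple of positive length). -/
def singleton (P : List ℕ) (hP : P ≠ []) : PointSet where
  carrier := {P}
  homogeneous := ⟨P.length, List.length_pos_iff.2 hP, fun _ hx => congrArg List.length hx⟩

/-- The Cartesian product `A × B`, through concatenation of tuples. -/
def prod (A B : PointSet) : PointSet where
  carrier := Set.image2 (fun a b => a ++ b) A.carrier B.carrier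
  homogeneous := by
    obtain ⟨k, hk, hA⟩ := A.homogeneous
    obtain ⟨l, _, hB⟩ := B.homogeneous
    refine ⟨k + l, by omega, ?_⟩
    rintro _ ⟨a, ha, b, hb, rfl⟩
    simp [hA a ha, hB b hb]

/-- The (finite) set `X_n` of the points of `X` all of whose coordinates are at most `n`. -/
def trunc (X : PointSet) (n : ℕ) : Set (List ℕ) :=
  {x ∈ X.carrier | ∀ i ∈ x, i ≤ n}

/-- The cardinality `|X_n|`. -/
noncomputable def count (X : PointSet) (n : ℕ) : ℕ := (X.trunc n).ncard

end PointSet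

/-- An equinumerosity: an equivalence relation on point sets with the properties (E1) - (E4). -/
@[ext]
structure Equinumerosity extends Setoid PointSet where
  e1 : ∀ A B : PointSet, r A B ↔ r (A.diff B) (B.diff A)
  e2_exists : ∀ A B : PointSet,
    r A B ∨ (∃ A' : PointSet, A'.carrier ⊂ A.carrier ∧ r A' B) ∨
      (∃ B' : PointSet, B'.carrier ⊂ B.carrier ∧ r A B')
  e2_ab : ∀ A B : PointSet,
    ¬ (r A B ∧ ∃ A' : PointSet, A'.carrier ⊂ A.carrier ∧ r A' B)
  e2_ac : ∀ A B : PointSet,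
    ¬ (r A B ∧ ∃ B' : PointSet, B'.carrier ⊂ B.carrier ∧ r A B')
  e2_bc : ∀ A B : PointSet,
    ¬ ((∃ A' : PointSet, A'.carrier ⊂ A.carrier ∧ r A' B) ∧
      ∃ B' : PointSet, B'.carrier ⊂ B.carrier ∧ r A B')
  e3_right : ∀ (A : PointSet) (P : List ℕ) (hP : P ≠ []), r (A.prod (PointSet.singleton P hP)) A
  e3_left : ∀ (A : PointSet) (P : List ℕ) (hP : P ≠ []), r ((PointSet.singleton P hP).prod A) A
  e4 : ∀ A A' B B' : PointSet, r A A' → r B B' → r (A.prod B) (A'.prod B')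

namespace Equinumerosity

/-- (E0): the equinumerosity is asymptotic. -/
def IsAsymptotic (E : Equinumerosity) : Prop :=
  ∀ X Y : PointSet, (∀ n, X.count n ≤ Y.count n) →
    ∃ Z : PointSet, Z.carrier ⊆ Y.carrier ∧ E.r X Z

/-- The set of numerosities: the quotient of the family of all point sets. -/
def Numerosity (E : Equinumerosity) : Type := Quotient E.toSetoid

/-- The numerosity function. -/
def num (E : Equinumerosity) (A : PointSet) : E.Numerosity := Quotient.mk E.toSetoid A

variable {E : Equinumerosity}

theorem num_eq_num {A B : PointSet} : E.num A = E.num B ↔ E.r A B :=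
  Quotient.eq (r := E.toSetoid)

theorem r_refl (A : PointSet) : E.r A A := E.iseqv.refl A

theorem r_symm {A B : PointSet} (h : E.r A B) : E.r B A := E.iseqv.symm h

theorem r_trans {A B C : PointSet} (h : E.r A B) (h' : E.r B C) : E.r A C := E.iseqv.trans h h'

theorem exists_ssubset {A B X : PointSet} (h : E.r A B) (hX : X.carrier ⊂ A.carrier) :
    ∃ Y : PointSet, Y.carrier ⊂ B.carrier ∧ E.r X Y := by
  rcases E.e2_exists X B with h1 | ⟨X', hX', h1⟩ | h1
  · exact (E.e2_ab A A ⟨r_refl A, X, hX, r_trans h1 (r_symm h)⟩).elim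
  · exact (E.e2_ab A A ⟨r_refl A, X', hX'.trans hX, r_trans h1 (r_symm h)⟩).elim
  · exact h1

/-- `num A < num B` if and only if `A` is equinumerous to a proper subset of `B`. -/
instance : LT E.Numerosity where
  lt := Quotient.lift₂
    (fun A B : PointSet => ∃ B' : PointSet, B'.carrier ⊂ B.carrier ∧ E.r A B') (by
      have key : ∀ A B A' B' : PointSet, E.r A A' → E.r B B' →
          (∃ C : PointSet, C.carrier ⊂ B.carrier ∧ E.r A C) →
          ∃ C : PointSet, C.carrier ⊂ B'.carrier ∧ E.r A' C := by
        rintro A B A' B' hA hB ⟨C, hC, h⟩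
        obtain ⟨D, hD, h'⟩ := exists_ssubset hB hC
        exact ⟨D, hD, r_trans (r_symm hA) (r_trans h h')⟩
      exact fun A B A' B' hA hB => propext
        ⟨key A B A' B' hA hB, key A' B' A B (r_symm hA) (r_symm hB)⟩)

theorem num_lt_num {A B : PointSet} :
    E.num A < E.num B ↔ ∃ B' : PointSet, B'.carrier ⊂ B.carrier ∧ E.r A B' := Iff.rfl

instance : LE E.Numerosity where
  le x y := x < y ∨ x = y

/-- `num A * num B = num (A × B)`. -/
instance : Mul E.Numerosity where
  mul := Quotient.map₂ PointSet.prod fun A A' hA B B' hB => E.e4 A A' B B' hA hB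

theorem num_mul_num (A B : PointSet) : E.num A * E.num B = E.num (A.prod B) := rfl

/-- `z` is the numerosity of a disjoint union of point sets (necessarily of the same dimension)
of numerosities `x` and `y`. -/
def IsSum (x y z : E.Numerosity) : Prop :=
  ∃ A B C : PointSet, Disjoint A.carrier B.carrier ∧ C.carrier = A.carrier ∪ B.carrier ∧
    E.num A = x ∧ E.num B = y ∧ E.num C = z

theorem exists_lifts {k l : ℕ} (C D : PointSet) (hC : ∀ x ∈ C.carrier, x.length = k)
    (hD : ∀ x ∈ D.carrier, x.length = l) :
    ∃ P Q : List ℕ, P ≠ [] ∧ Q ≠ [] ∧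
      (∀ x ∈ C.carrier, (P ++ x).length = k + l + 1) ∧
      (∀ x ∈ D.carrier, (Q ++ x).length = k + l + 1) ∧
      ∀ x y : List ℕ, P ++ x ≠ Q ++ y := by
  refine ⟨0 :: List.replicate l 0, 1 :: List.replicate k 0, by simp, by simp, ?_, ?_, by simp⟩
  · intro x hx
    simp [hC x hx, Nat.add_comm]
  · intro x hx
    simp [hD x hx]

theorem image_aux {α β : Type*} {f g : α → β} (hf : Function.Injective f)
    (hfg : ∀ x y, f x ≠ g y) {A B : Set α} (A' : Set α) (hd : Disjoint A B) :
    f '' (A ∪ B) \ (g '' A' ∪ f '' B) = f '' A ∧ (g '' A' ∪ f '' B) \ f '' (A ∪ B) = g '' A' := by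
  have hd := Set.disjoint_left.1 hd
  refine ⟨Set.ext fun x => ⟨?_, ?_⟩, Set.ext fun x => ⟨?_, ?_⟩⟩
  · rintro ⟨⟨a, ha | ha, rfl⟩, h⟩
    · exact ⟨a, ha, rfl⟩
    · exact (h (Or.inr ⟨a, ha, rfl⟩)).elim
  · rintro ⟨a, ha, rfl⟩
    refine ⟨⟨a, Or.inl ha, rfl⟩, ?_⟩
    rintro (⟨b, _, h⟩ | ⟨b, hb, h⟩)
    · exact hfg _ _ h.symm
    · exact hd ha (hf h ▸ hb)
  · rintro ⟨h | ⟨a, ha, rfl⟩, h'⟩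
    · exact h
    · exact (h' ⟨a, Or.inr ha, rfl⟩).elim
  · rintro ⟨a, ha, rfl⟩
    exact ⟨Or.inl ⟨a, ha, rfl⟩, fun ⟨b, _, h⟩ => hfg _ _ h⟩

theorem carrier_lift (P : List ℕ) (hP : P ≠ []) (A : PointSet) :
    ((PointSet.singleton P hP).prod A).carrier = (fun x => P ++ x) '' A.carrier := by
  simp [PointSet.prod, PointSet.singleton]

theorem mem_lift {P : List ℕ} {hP : P ≠ []} {A : PointSet} {x : List ℕ} :
    x ∈ ((PointSet.singleton P hP).prod A).carrier ↔ ∃ a ∈ A.carrier, P ++ a = x := by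
  simp [PointSet.prod, PointSet.singleton]

theorem sum_congr {A B C A' B' C' : PointSet} (hd : Disjoint A.carrier B.carrier)
    (hC : C.carrier = A.carrier ∪ B.carrier) (hd' : Disjoint A'.carrier B'.carrier)
    (hC' : C'.carrier = A'.carrier ∪ B'.carrier) (hA : E.r A A') (hB : E.r B B') :
    E.r C C' := by
  obtain ⟨k, hk, hkC⟩ := C.homogeneous
  obtain ⟨l, hl, hlC⟩ := C'.homogeneous
  obtain ⟨P, Q, hP, hQ, h1, h2, hPQ⟩ := exists_lifts C C' hkC hlC
  have L : ∀ X, E.r X ((PointSet.singleton P hP).prod X) := fun X => r_symm (E.e3_left X P hP)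
  have L' : ∀ X, E.r X ((PointSet.singleton Q hQ).prod X) := fun X => r_symm (E.e3_left X Q hQ)
  let M : PointSet :=
    { carrier := ((PointSet.singleton Q hQ).prod A').carrier ∪
        ((PointSet.singleton P hP).prod B).carrier
      homogeneous := by
        refine ⟨k + l + 1, by omega, ?_⟩
        rintro x (hx | hx)
        · obtain ⟨a, ha, rfl⟩ := mem_lift.1 hx
          exact h2 a (hC' ▸ Or.inl ha)
        · obtain ⟨a, ha, rfl⟩ := mem_lift.1 hx
          exact h1 a (hC ▸ Or.inr ha) }
  have a1 := image_aux (f := fun x => P ++ x) (g := fun x => Q ++ x)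
    (fun _ _ h => List.append_cancel_left h) hPQ A'.carrier hd
  have a2 := image_aux (f := fun x => Q ++ x) (g := fun x => P ++ x)
    (fun _ _ h => List.append_cancel_left h) (fun x y h => hPQ y x h.symm) B.carrier hd'.symm
  rw [← hC] at a1
  rw [Set.union_comm, ← hC', Set.union_comm] at a2
  simp only [← carrier_lift P hP, ← carrier_lift Q hQ] at a1 a2
  have s1 : E.r ((PointSet.singleton P hP).prod C) M := by
    rw [E.e1, show PointSet.diff _ M = (PointSet.singleton P hP).prod A from PointSet.ext a1.1,
      show PointSet.diff M _ = (PointSet.singleton Q hQ).prod A' from PointSet.ext a1.2]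
    exact r_trans (r_symm (L A)) (r_trans hA (L' A'))
  have s2 : E.r M ((PointSet.singleton Q hQ).prod C') := by
    rw [E.e1, show PointSet.diff M _ = (PointSet.singleton P hP).prod B from PointSet.ext a2.2,
      show PointSet.diff _ M = (PointSet.singleton Q hQ).prod B' from PointSet.ext a2.1]
    exact r_trans (r_symm (L B)) (r_trans hB (L' B'))
  exact r_trans (L C) (r_trans s1 (r_trans s2 (r_symm (L' C'))))

theorem existsUnique_isSum (x y : E.Numerosity) : ∃! z, IsSum x y z := by
  induction x using Quotient.inductionOn with | _ A
  induction y using Quotient.inductionOn with | _ B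
  obtain ⟨k, hk, hkA⟩ := A.homogeneous
  obtain ⟨l, hl, hlB⟩ := B.homogeneous
  obtain ⟨P, Q, hP, hQ, h1, h2, hPQ⟩ := exists_lifts A B hkA hlB
  refine existsUnique_of_exists_of_unique ?_ ?_
  · refine ⟨E.num
      { carrier := ((PointSet.singleton P hP).prod A).carrier ∪
          ((PointSet.singleton Q hQ).prod B).carrier
        homogeneous := ?_ }, _, _, _, ?_, rfl, num_eq_num.2 (E.e3_left A P hP),
          num_eq_num.2 (E.e3_left B Q hQ), rfl⟩
    · refine ⟨k + l + 1, by omega, ?_⟩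
      rintro x (hx | hx)
      · obtain ⟨a, ha, rfl⟩ := mem_lift.1 hx
        exact h1 a ha
      · obtain ⟨a, ha, rfl⟩ := mem_lift.1 hx
        exact h2 a ha
    · refine Set.disjoint_left.2 fun x hx hx' => ?_
      obtain ⟨a, ha, rfl⟩ := mem_lift.1 hx
      obtain ⟨b, hb, h⟩ := mem_lift.1 hx'
      exact hPQ a b h.symm
  · rintro z z' ⟨A₁, B₁, C₁, hd, hC, hA, hB, rfl⟩ ⟨A₂, B₂, C₂, hd', hC', hA', hB', rfl⟩
    exact num_eq_num.2 (sum_congr hd hC hd' hC' (num_eq_num.1 (hA.trans hA'.symm))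
      (num_eq_num.1 (hB.trans hB'.symm)))

/-- Addition of numerosities is given by disjoint union (see `num_add_num`). -/
noncomputable instance : Add E.Numerosity where
  add x y := (existsUnique_isSum x y).choose

theorem num_add_num {A B C : PointSet} (hd : Disjoint A.carrier B.carrier)
    (hC : C.carrier = A.carrier ∪ B.carrier) : E.num A + E.num B = E.num C :=
  (existsUnique_isSum (E.num A) (E.num B)).unique
    (existsUnique_isSum (E.num A) (E.num B)).choose_spec.1 ⟨A, B, C, hd, hC, rfl, rfl, rfl⟩

instance : Zero E.Numerosity := ⟨E.num PointSet.empty⟩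

/-- `1` is the numerosity of a singleton; the choice of the singleton is immaterial. -/
instance : One E.Numerosity := ⟨E.num (PointSet.singleton [0] (by simp))⟩

end Equinumerosity

/-- A nonprincipal ultrafilter on `ℕ` such that every `f` with `f n ≤ n` for all `n` agrees with a
nondecreasing function on a set of the ultrafilter. -/
def QuasiSelective (U : Ultrafilter ℕ) : Prop :=
  (∀ n : ℕ, U ≠ pure n) ∧
    ∀ f : ℕ → ℕ, (∀ n, f n ≤ n) → ∃ g : ℕ → ℕ, Monotone g ∧ {n | f n = g n} ∈ U

/-- `f` is eventually dominated by a power of `n`. -/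
def PolynomiallyBounded (f : ℕ → ℕ) : Prop :=
  ∃ k m : ℕ, ∀ n > m, f n < n ^ k

/-- The classes of the polynomially bounded sequences, as a subset of the ultrapower of `ℕ`
modulo `U`; they are closed under the semiring operations. -/
def polynomialPart (U : Ultrafilter ℕ) : Subsemiring ((U : Filter ℕ).Germ ℕ) where
  carrier := {x | ∃ f : ℕ → ℕ, PolynomiallyBounded f ∧ x = (f : (U : Filter ℕ).Germ ℕ)}
  mul_mem' := by
    rintro _ _ ⟨f, ⟨k, m, hf⟩, rfl⟩ ⟨g, ⟨l, p, hg⟩, rfl⟩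
    refine ⟨f * g, ⟨k + l, m + p, fun n hn => ?_⟩, rfl⟩
    rw [pow_add]
    exact Nat.mul_lt_mul'' (hf n (by omega)) (hg n (by omega))
  one_mem' := ⟨fun _ => 1, ⟨1, 1, fun n hn => by simpa using hn⟩, rfl⟩
  add_mem' := by
    rintro _ _ ⟨f, ⟨k, m, hf⟩, rfl⟩ ⟨g, ⟨l, p, hg⟩, rfl⟩
    refine ⟨f + g, ⟨k + l + 1, m + p + 2, fun n hn => ?_⟩, rfl⟩
    have h1 := hf n (by omega)
    have h2 := hg n (by omega)
    have h3 : n ^ k ≤ n ^ (k + l) := Nat.pow_le_pow_right (by omega) (by omega)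
    have h4 : n ^ l ≤ n ^ (k + l) := Nat.pow_le_pow_right (by omega) (by omega)
    have h5 : n ^ (k + l) * 2 ≤ n ^ (k + l) * n := Nat.mul_le_mul_left _ (by omega)
    have h6 : n ^ (k + l + 1) = n ^ (k + l) * n := pow_succ n (k + l)
    show f n + g n < _
    omega
  zero_mem' := ⟨fun _ => 0, ⟨0, 0, fun n _ => by simp⟩, rfl⟩

/-! Both directions rest on the fact that the counting functions of subsets of `B` are exactly the
sequences whose initial value and increments are nonnegative and bounded by those of `B.count`:
select the right number of points of each height.

From ultrafilter to equinumerosity, quasi-selectivity applied to base-`n` digits makes every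
polynomially bounded sequence nondecreasing modulo `U`. If `f ≤ B.count` modulo `U`, then `f` and
`B.count - f` both agree with nondecreasing sequences on some set in `U`. The increments of `f`
along that set are therefore admissible, `f` extends admissibly to all of `ℕ`, and a subset of `B`
realizes it (`QuasiSelective.exists_subset_count_eq`). This yields (E2), (E0) and surjectivity onto
the polynomial part; the other properties are pointwise arithmetic of counts.

Conversely, the sets `{n | |X_n| = |Y_n|}` with `X ≈ Y` generate a filter, since two equations
combine into one by adding squares of differences. The algebra of numerosities and cancellation
(`IsAsymptotic.dominated_of_add`) show that it is proper and determines `≈`. It is an ultrafilter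
because no numerosity lies strictly between `x` and `x + 1`, and quasi-selective because the
counting function of a difference set is nondecreasing. -/

/-! ### Counting functions and their realization -/

namespace PointSet

/-- The largest coordinate of a tuple. -/
def height (x : List ℕ) : ℕ := x.foldr max 0

theorem height_le_iff {x : List ℕ} {n : ℕ} : height x ≤ n ↔ ∀ i ∈ x, i ≤ n := by
  induction x with
  | nil => simp [height]
  | cons a x ih => simpa [height] using fun _ => ih

theorem mem_trunc {X : PointSet} {n : ℕ} {x : List ℕ} :
    x ∈ X.trunc n ↔ x ∈ X.carrier ∧ height x ≤ n := by
  rw [height_le_iff]; rfl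

/-- The set `ℕ ^ k` of all tuples of length `k`. -/
def full (k : ℕ) (hk : 0 < k) : PointSet := ⟨{x | x.length = k}, k, hk, fun _ hx => hx⟩

theorem trunc_full (k : ℕ) (hk : 0 < k) (n : ℕ) :
    (full k hk).trunc n =
      List.ofFn '' (Fintype.piFinset fun _ : Fin k => Finset.range (n + 1) : Set (Fin k → ℕ)) := by
  ext x
  constructor
  · rintro ⟨hx, h⟩
    obtain rfl : x.length = k := hx
    refine ⟨x.get, ?_, List.ofFn_get x⟩
    simp only [Finset.mem_coe, Fintype.mem_piFinset, Finset.mem_range]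
    exact fun i => Nat.lt_succ_of_le (h _ (List.get_mem x i))
  · rintro ⟨f, hf, rfl⟩
    simp only [Finset.mem_coe, Fintype.mem_piFinset, Finset.mem_range] at hf
    refine ⟨List.length_ofFn, fun i hi => ?_⟩
    obtain ⟨j, rfl⟩ := List.mem_ofFn.1 hi
    exact Nat.le_of_lt_succ (hf j)

theorem count_full (k : ℕ) (hk : 0 < k) (n : ℕ) : (full k hk).count n = (n + 1) ^ k := by
  rw [count, trunc_full, Set.ncard_image_of_injective _ List.ofFn_injective, Set.ncard_coe_finset]
  simp

theorem exists_trunc_subset_full (X : PointSet) :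
    ∃ (k : ℕ) (hk : 0 < k), ∀ n, X.trunc n ⊆ (full k hk).trunc n := by
  obtain ⟨k, hk, h⟩ := X.homogeneous
  exact ⟨k, hk, fun n x hx => ⟨h x hx.1, hx.2⟩⟩

theorem finite_trunc (X : PointSet) (n : ℕ) : (X.trunc n).Finite := by
  obtain ⟨k, hk, h⟩ := X.exists_trunc_subset_full
  refine Set.Finite.subset ?_ (h n)
  rw [trunc_full]
  exact (Finset.finite_toSet _).image _

theorem polynomiallyBounded_count (X : PointSet) : PolynomiallyBounded X.count := by
  obtain ⟨k, hk, h⟩ := X.exists_trunc_subset_full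
  -- For `n ≥ 2`, `n + 1 ≤ n ^ 2`; the extra factor `n` makes the bound strict.
  refine ⟨2 * k + 1, 1, fun n hn => ?_⟩
  have h1 : X.count n ≤ (n + 1) ^ k := by
    rw [← count_full k hk]
    exact Set.ncard_le_ncard (h n) (finite_trunc _ n)
  have h2 : (n + 1) ^ k ≤ n ^ (2 * k) := by
    rw [pow_mul]
    exact Nat.pow_le_pow_left (by nlinarith) k
  exact (h1.trans h2).trans_lt (Nat.pow_lt_pow_right hn (Nat.lt_succ_self _))

theorem trunc_mono (X : PointSet) {m n : ℕ} (h : m ≤ n) : X.trunc m ⊆ X.trunc n :=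
  fun _ hx => ⟨hx.1, fun i hi => (hx.2 i hi).trans h⟩

theorem count_mono (X : PointSet) : Monotone X.count :=
  fun _ _ h => Set.ncard_le_ncard (X.trunc_mono h) (finite_trunc _ _)

theorem eventually_count_lt_count {X Y : PointSet} (h : X.carrier ⊂ Y.carrier) :
    ∀ᶠ n in atTop, X.count n < Y.count n := by
  obtain ⟨p, hp, hp'⟩ := Set.exists_of_ssubset h
  filter_upwards [eventually_ge_atTop (height p)] with n hn
  refine Set.ncard_lt_ncard ⟨fun _ hx => ⟨h.1 hx.1, hx.2⟩, fun h' => hp' ?_⟩ (finite_trunc _ _)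
  exact (h' (mem_trunc.2 ⟨hp, hn⟩)).1

theorem count_union {A B C : PointSet} (hd : Disjoint A.carrier B.carrier)
    (hC : C.carrier = A.carrier ∪ B.carrier) (n : ℕ) : C.count n = A.count n + B.count n := by
  have hd' : Disjoint (A.trunc n) (B.trunc n) :=
    Set.disjoint_left.2 fun _ hx hx' => Set.disjoint_left.1 hd hx.1 hx'.1
  rw [count, count, count, ← Set.ncard_union_eq hd' (finite_trunc _ _) (finite_trunc _ _)]
  congr 1
  ext x
  simp only [mem_trunc, hC, Set.mem_union]
  tauto

theorem count_diff_add_inter (A B : PointSet) (n : ℕ) :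
    A.count n = (A.diff B).count n +
      (A.restrict (A.carrier ∩ B.carrier) Set.inter_subset_left).count n :=
  count_union (A := A.diff B) (B := A.restrict _ Set.inter_subset_left)
    (Set.disjoint_left.2 fun _ hx hx' => hx.2 hx'.2)
    (Set.sdiff_union_inter A.carrier B.carrier).symm n

theorem count_prod (A B : PointSet) (n : ℕ) : (A.prod B).count n = A.count n * B.count n := by
  obtain ⟨k, hk, hA⟩ := A.homogeneous
  rw [count, count, count, ← Set.ncard_prod]
  have : (A.prod B).trunc n = (fun p : List ℕ × List ℕ => p.1 ++ p.2) '' A.trunc n ×ˢ B.trunc n := by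
    ext x
    constructor
    · rintro ⟨⟨a, ha, b, hb, rfl⟩, h⟩
      exact ⟨(a, b), ⟨⟨ha, fun i hi => h i (List.mem_append_left _ hi)⟩,
        ⟨hb, fun i hi => h i (List.mem_append_right _ hi)⟩⟩, rfl⟩
    · rintro ⟨⟨a, b⟩, ⟨ha, hb⟩, rfl⟩
      exact ⟨⟨a, ha.1, b, hb.1, rfl⟩,
        fun i hi => (List.mem_append.1 hi).elim (ha.2 i) (hb.2 i)⟩
  -- Concatenation is injective here because all points of `A` have the same length.
  rw [this, Set.InjOn.ncard_image]
  rintro ⟨a, b⟩ ⟨ha, _⟩ ⟨a', b'⟩ ⟨ha', _⟩ h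
  obtain ⟨h1, h2⟩ := List.append_inj h ((hA a ha.1).trans (hA a' ha'.1).symm)
  exact Prod.ext h1 h2

theorem count_empty (n : ℕ) : empty.count n = 0 := by
  have : empty.trunc n = ∅ := Set.eq_empty_of_forall_notMem fun _ hx => hx.1
  rw [count, this, Set.ncard_empty]

theorem count_singleton {P : List ℕ} (hP : P ≠ []) (n : ℕ) :
    (singleton P hP).count n = if height P ≤ n then 1 else 0 := by
  split_ifs with h
  · have : (singleton P hP).trunc n = {P} := by
      ext x
      rw [mem_trunc]
      exact ⟨fun hx => hx.1, fun hx => ⟨hx, by rwa [Set.mem_singleton_iff.1 hx]⟩⟩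
    rw [count, this, Set.ncard_singleton]
  · have : (singleton P hP).trunc n = ∅ := by
      refine Set.eq_empty_of_forall_notMem fun x hx => h ?_
      rw [mem_trunc] at hx
      rw [← show x = P from hx.1]
      exact hx.2
    rw [count, this, Set.ncard_empty]

theorem eventually_count_singleton {P : List ℕ} (hP : P ≠ []) :
    ∀ᶠ n in atTop, (singleton P hP).count n = 1 := by
  filter_upwards [eventually_ge_atTop (height P)] with n hn
  rw [count_singleton, if_pos hn]

/-- A sequence is the counting function of a subset of `B` as soon as its increments are nonnegative
and do not exceed those of the counting function of `B`. -/
theorem exists_subset_count_eq (B : PointSet) (g : ℕ → ℕ) (h0 : g 0 ≤ B.count 0)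
    (hg : ∀ n, g n ≤ g (n + 1)) (hb : ∀ n, g (n + 1) + B.count n ≤ g n + B.count (n + 1)) :
    ∃ Z : PointSet, Z.carrier ⊆ B.carrier ∧ ∀ n, Z.count n = g n := by
  -- The points of height `n` are those that enter the truncation at stage `n`; choose as many as
  -- `g` grows there. The case `n = 0` is separate because `g (0 - 1)` would be `g 0`.
  have key : ∀ n, ∃ t ⊆ {x ∈ B.carrier | height x = n},
      t.ncard = g n - if n = 0 then 0 else g (n - 1) := by
    intro n
    refine Set.exists_subset_card_eq ?_
    cases n with
    | zero =>
      have : {x ∈ B.carrier | height x = 0} = B.trunc 0 := by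
        ext x; simp [mem_trunc]
      simpa [this, count] using h0
    | succ n =>
      have hd : B.trunc (n + 1) = {x ∈ B.carrier | height x = n + 1} ∪ B.trunc n := by
        ext x
        simp only [mem_trunc, Set.mem_union, Set.mem_ofPred_eq, ← and_or_left]
        exact and_congr_right fun _ => by omega
      have hfin : {x ∈ B.carrier | height x = n + 1}.Finite :=
        (B.finite_trunc (n + 1)).subset (hd ▸ Set.subset_union_left)
      have hc : B.count (n + 1) = {x ∈ B.carrier | height x = n + 1}.ncard + B.count n := by
        rw [count, hd, Set.ncard_union_eq _ hfin (finite_trunc _ _)]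
        · rfl
        · refine Set.disjoint_left.2 fun x hx hx' => ?_
          have := (mem_trunc.1 hx').2
          have := hx.2
          omega
      have := hb n
      simp only [Nat.add_eq_zero_iff, one_ne_zero, and_false, if_false, Nat.add_sub_cancel]
      omega
  choose t ht hcard using key
  have hsub : {x ∈ B.carrier | x ∈ t (height x)} ⊆ B.carrier := Set.sep_subset _ _
  have hmem : ∀ {x n}, x ∈ t n → x ∈ B.carrier ∧ height x = n := fun hx => ht _ hx
  refine ⟨B.restrict _ hsub, hsub, fun n => ?_⟩
  induction n with
  | zero =>
    have : (B.restrict _ hsub).trunc 0 = t 0 := by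
      ext x
      rw [mem_trunc]
      constructor
      · rintro ⟨⟨_, h⟩, h'⟩
        rwa [Nat.le_zero.1 h'] at h
      · intro hx
        obtain ⟨h1, h2⟩ := hmem hx
        exact ⟨⟨h1, by rwa [h2]⟩, h2.le⟩
    rw [count, this, hcard]
    simp
  | succ n ih =>
    have : (B.restrict _ hsub).trunc (n + 1) = t (n + 1) ∪ (B.restrict _ hsub).trunc n := by
      ext x
      rw [Set.mem_union, mem_trunc, mem_trunc]
      constructor
      · rintro ⟨⟨h1, h⟩, h'⟩
        rcases Nat.le_succ_iff.1 h' with h' | h'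
        · exact Or.inr ⟨⟨h1, h⟩, h'⟩
        · exact Or.inl (by rwa [h'] at h)
      · rintro (hx | ⟨hx, h⟩)
        · obtain ⟨h1, h2⟩ := hmem hx
          exact ⟨⟨h1, by rwa [h2]⟩, h2.le⟩
        · exact ⟨hx, h.trans n.le_succ⟩
    rw [count, this, Set.ncard_union_eq _ _ (finite_trunc _ _), hcard]
    · rw [← count, ih]
      have := hg n
      simp only [Nat.add_eq_zero_iff, one_ne_zero, and_false, if_false, Nat.add_sub_cancel]
      omega
    · refine Set.disjoint_left.2 fun x hx hx' => ?_
      have := (mem_trunc.1 hx').2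
      have := (hmem hx).2
      omega
    · exact (B.finite_trunc (n + 1)).subset fun x hx => mem_trunc.2 ⟨(hmem hx).1, (hmem hx).2.le⟩

/-- The square absorbs every decrease of `f`, since `f n + n ^ 2 ≤ (n + 1) ^ 2`, and the increments
are at most `3 * n + 2`, below those of `(n + 1) ^ 3`. -/
theorem exists_count_eq_add_sq (f : ℕ → ℕ) (hf : ∀ n, f n ≤ n) :
    ∃ X : PointSet, ∀ n, X.count n = f n + n ^ 2 := by
  obtain ⟨X, -, hX⟩ := exists_subset_count_eq (full 3 (by norm_num)) (fun n => f n + n ^ 2)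
    (by have := hf 0; rw [count_full]; simp; omega)
    (fun n => by have := hf n; show f n + n ^ 2 ≤ f (n + 1) + (n + 1) ^ 2; nlinarith)
    (fun n => by have := hf (n + 1); simp only [count_full]; nlinarith)
  exact ⟨X, hX⟩

end PointSet

/-! ### Nondecreasing representatives modulo a quasi-selective ultrafilter -/

namespace QuasiSelective

variable {U : Ultrafilter ℕ}

theorem le_atTop (hU : QuasiSelective U) : (U : Filter ℕ) ≤ atTop := by
  rw [← Nat.cofinite_eq_atTop]
  exact U.le_cofinite_or_eq_pure.resolve_right fun ⟨n, hn⟩ => hU.1 n hn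

/-- Write `f n = n * (f n / n) + f n % n`: the quotient has a lower degree bound, the remainder
falls under quasi-selectivity, and nondecreasing representatives recombine to a nondecreasing one.
-/
theorem exists_monotone_of_lt_pow (hU : QuasiSelective U) (k : ℕ) (f : ℕ → ℕ)
    (hf : ∀ᶠ n in (U : Filter ℕ), f n < n ^ k) :
    ∃ g : ℕ → ℕ, Monotone g ∧ ∀ᶠ n in (U : Filter ℕ), f n = g n := by
  induction k generalizing f with
  | zero =>
    refine ⟨fun _ => 0, monotone_const, hf.mono fun n hn => ?_⟩
    simpa using hn
  | succ k ih =>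
    obtain ⟨g, hg, hg'⟩ := ih (fun n => f n / n)
      (hf.mono fun n hn => Nat.div_lt_of_lt_mul (by rwa [pow_succ'] at hn))
    -- The `min` matters only at `n = 0`, where `f 0 % 0 = f 0` may be positive.
    obtain ⟨h, hh, hh'⟩ := hU.2 (fun n => min (f n % n) n) fun n => min_le_right _ _
    refine ⟨fun n => n * g n + h n, fun a b hab => ?_, ?_⟩
    · exact Nat.add_le_add (Nat.mul_le_mul hab (hg hab)) (hh hab)
    · have hh'' : ∀ᶠ n in (U : Filter ℕ), min (f n % n) n = h n := hh'
      filter_upwards [hg', hh'', hU.le_atTop (eventually_gt_atTop 0)] with n h1 h2 h3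
      rw [min_eq_left (Nat.mod_lt _ h3).le] at h2
      rw [← h1, ← h2, Nat.div_add_mod]

theorem exists_monotone (hU : QuasiSelective U) {f : ℕ → ℕ} (hf : PolynomiallyBounded f) :
    ∃ g : ℕ → ℕ, Monotone g ∧ ∀ᶠ n in (U : Filter ℕ), f n = g n := by
  obtain ⟨k, m, h⟩ := hf
  exact hU.exists_monotone_of_lt_pow k f (hU.le_atTop ((eventually_gt_atTop m).mono h))

end QuasiSelective

theorem PolynomiallyBounded.mono {f g : ℕ → ℕ} (hg : PolynomiallyBounded g) (h : ∀ n, f n ≤ g n) :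
    PolynomiallyBounded f := by
  obtain ⟨k, m, hg⟩ := hg
  exact ⟨k, m, fun n hn => (h n).trans_lt (hg n hn)⟩

/-- If `b` is nondecreasing and the increments of `g` on `S` are nonnegative and bounded by those of
`b`, then `g` has an extension from `S` to `ℕ` with the same property. -/
theorem exists_extension {b g : ℕ → ℕ} {S : Set ℕ} (hb : Monotone b)
    (h0 : ∀ s ∈ S, g s ≤ b s)
    (hS : ∀ s ∈ S, ∀ t ∈ S, s ≤ t → g s ≤ g t ∧ g t + b s ≤ g s + b t) :
    ∃ e : ℕ → ℕ, e 0 ≤ b 0 ∧ (∀ n, e n ≤ e (n + 1)) ∧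
      (∀ n, e (n + 1) + b n ≤ e n + b (n + 1)) ∧ ∀ s ∈ S, e s = g s := by
  -- The infimum of `T n` is the largest value the constraints permit. Truncated subtraction covers
  -- both sides of `s`: for `n ≤ s` the bound is just `g s`.
  let T : ℕ → Set ℕ := fun n => insert (b n) ((fun s => g s + (b n - b s)) '' S)
  have hT : ∀ n, (T n).Nonempty := fun n => ⟨b n, Or.inl rfl⟩
  have le_b : ∀ n, sInf (T n) ≤ b n := fun n => Nat.sInf_le (Or.inl rfl)
  have le_g : ∀ n, ∀ s ∈ S, sInf (T n) ≤ g s + (b n - b s) := fun n s hs =>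
    Nat.sInf_le (Or.inr ⟨s, hs, rfl⟩)
  have mem : ∀ n, sInf (T n) = b n ∨ ∃ s ∈ S, g s + (b n - b s) = sInf (T n) := fun n =>
    Nat.sInf_mem (hT n)
  refine ⟨fun n => sInf (T n), le_b 0, fun n => ?_, fun n => ?_, fun t ht => ?_⟩
  · have := hb n.le_succ
    rcases mem (n + 1) with h | ⟨s, hs, h⟩
    · have := le_b n
      simp only [Nat.succ_eq_add_one] at *
      omega
    · have := le_g n s hs
      simp only [Nat.succ_eq_add_one] at *
      omega
  · have := hb n.le_succ
    rcases mem n with h | ⟨s, hs, h⟩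
    · have := le_b (n + 1)
      simp only [Nat.succ_eq_add_one] at *
      omega
    · have := le_g (n + 1) s hs
      simp only [Nat.succ_eq_add_one] at *
      omega
  · have h1 := le_g t t ht
    have h2 := h0 t ht
    rcases mem t with h | ⟨s, hs, h⟩
    · simp only at *
      omega
    · rcases le_total s t with hst | hst
      · have := hS s hs t ht hst
        simp only at *
        omega
      · have := hS t ht s hs hst
        simp only at *
        omega

/-! ### The equinumerosity of a quasi-selective ultrafilter -/

namespace QuasiSelective

variable {U : Ultrafilter ℕ}

/-- Monotonicity of `f` on a set of `U` bounds its increments below by zero; monotonicity of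
`B.count - f` bounds them above by those of `B.count`. -/
theorem exists_subset_count_eq (hU : QuasiSelective U) (B : PointSet) (f : ℕ → ℕ)
    (hf : ∀ᶠ n in (U : Filter ℕ), f n ≤ B.count n) :
    ∃ Z : PointSet, Z.carrier ⊆ B.carrier ∧ ∀ᶠ n in (U : Filter ℕ), Z.count n = f n := by
  have hB := B.polynomiallyBounded_count
  obtain ⟨g, hg, hg'⟩ := hU.exists_monotone (f := fun n => min (f n) (B.count n))
    (hB.mono fun n => min_le_right _ _)
  obtain ⟨h, hh, hh'⟩ := hU.exists_monotone (f := fun n => B.count n - f n)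
    (hB.mono fun n => Nat.sub_le _ _)
  obtain ⟨e, h0, he, heb, heS⟩ := exists_extension (b := B.count) (g := g)
    (S := {n | f n = g n ∧ B.count n - f n = h n ∧ f n ≤ B.count n}) B.count_mono
    (by rintro s ⟨h1, h2, h3⟩; omega) (by
      rintro s ⟨h1, h2, h3⟩ t ⟨h4, h5, h6⟩ hst
      have h7 := hg hst
      have h8 := hh hst
      omega)
  obtain ⟨Z, hZ, hZe⟩ := B.exists_subset_count_eq e h0 he heb
  refine ⟨Z, hZ, ?_⟩
  filter_upwards [hf, hg', hh'] with n h1 h2 h3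
  rw [min_eq_left h1] at h2
  rw [hZe, heS n ⟨h2, h3, h1⟩, h2]

/-- This turns (E2) into the trichotomy of the order modulo `U`. A proper subset omits a point,
hence counts strictly less from the height of that point on. -/
theorem exists_ssubset_count_eq_iff (hU : QuasiSelective U) (A B : PointSet) :
    (∃ B' : PointSet, B'.carrier ⊂ B.carrier ∧ ∀ᶠ n in (U : Filter ℕ), A.count n = B'.count n) ↔
      ∀ᶠ n in (U : Filter ℕ), A.count n < B.count n := by
  constructor
  · rintro ⟨B', hB', h⟩
    filter_upwards [h, hU.le_atTop (PointSet.eventually_count_lt_count hB')] with n h1 h2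
    omega
  · intro h
    obtain ⟨Z, hZ, hZ'⟩ := hU.exists_subset_count_eq B A.count (h.mono fun _ => le_of_lt)
    refine ⟨Z, hZ.ssubset_of_ne fun hne => ?_, hZ'.mono fun _ => Eq.symm⟩
    obtain rfl : Z = B := PointSet.ext hne
    obtain ⟨n, h1, h2⟩ := (hZ'.and h).exists
    omega

/-- The equinumerosity given by a quasi-selective ultrafilter. -/
def equinumerosity (hU : QuasiSelective U) : Equinumerosity where
  r X Y := ∀ᶠ n in (U : Filter ℕ), X.count n = Y.count n
  iseqv := ⟨fun _ => .of_forall fun _ => rfl, fun h => h.mono fun _ => Eq.symm,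
    fun h h' => by filter_upwards [h, h'] with n h1 h2 using h1.trans h2⟩
  e1 A B := by
    refine eventually_congr (.of_forall fun n => ?_)
    have h1 := A.count_diff_add_inter B n
    have h2 := B.count_diff_add_inter A n
    have h3 : A.restrict (A.carrier ∩ B.carrier) Set.inter_subset_left =
      B.restrict (B.carrier ∩ A.carrier) Set.inter_subset_left :=
        PointSet.ext (Set.inter_comm _ _)
    rw [h3] at h1
    omega
  e2_exists A B := by
    have h := hU.exists_ssubset_count_eq_iff B A
    simp only [eq_comm (a := B.count _)] at h
    rw [h, hU.exists_ssubset_count_eq_iff A B, ← Ultrafilter.eventually_or,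
      ← Ultrafilter.eventually_or]
    exact .of_forall fun n => by omega
  e2_ab A B := by
    have h := hU.exists_ssubset_count_eq_iff B A
    simp only [eq_comm (a := B.count _)] at h
    rw [h]
    rintro ⟨h1, h2⟩
    obtain ⟨n, h1, h2⟩ := (h1.and h2).exists
    omega
  e2_ac A B := by
    rw [hU.exists_ssubset_count_eq_iff A B]
    rintro ⟨h1, h2⟩
    obtain ⟨n, h1, h2⟩ := (h1.and h2).exists
    omega
  e2_bc A B := by
    have h := hU.exists_ssubset_count_eq_iff B A
    simp only [eq_comm (a := B.count _)] at h
    rw [h, hU.exists_ssubset_count_eq_iff A B]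
    rintro ⟨h1, h2⟩
    obtain ⟨n, h1, h2⟩ := (h1.and h2).exists
    omega
  e3_right A P hP := by
    filter_upwards [hU.le_atTop (PointSet.eventually_count_singleton hP)] with n h
    rw [PointSet.count_prod, h, mul_one]
  e3_left A P hP := by
    filter_upwards [hU.le_atTop (PointSet.eventually_count_singleton hP)] with n h
    rw [PointSet.count_prod, h, one_mul]
  e4 A A' B B' hA hB := by
    filter_upwards [hA, hB] with n h1 h2
    rw [PointSet.count_prod, PointSet.count_prod, h1, h2]

theorem isAsymptotic_equinumerosity (hU : QuasiSelective U) : hU.equinumerosity.IsAsymptotic := by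
  intro X Y h
  obtain ⟨Z, hZ, hZ'⟩ := hU.exists_subset_count_eq Y X.count (.of_forall h)
  exact ⟨Z, hZ, hZ'.mono fun _ => Eq.symm⟩

end QuasiSelective

/-! ### Comparison of numerosities -/

namespace Equinumerosity

variable {E : Equinumerosity}

/-- The numerosity of `X` is at most that of `Y`. -/
def Dominated (E : Equinumerosity) (X Y : PointSet) : Prop :=
  ∃ Z : PointSet, Z.carrier ⊆ Y.carrier ∧ E.r X Z

theorem not_r_of_ssubset {X Y : PointSet} (h : X.carrier ⊂ Y.carrier) : ¬ E.r Y X :=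
  fun h' => E.e2_ac Y Y ⟨r_refl Y, X, h, h'⟩

/-- Otherwise two of the exclusive alternatives of (E2) would hold together. Antisymmetry of
domination follows. -/
theorem Dominated.not_r_ssubset {X Y X' : PointSet} (h : E.Dominated X Y)
    (hX' : X'.carrier ⊂ X.carrier) : ¬ E.r Y X' := by
  intro h'
  obtain ⟨Z, hZ, hXZ⟩ := h
  by_cases hZY : Z.carrier = Y.carrier
  · obtain rfl : Z = Y := PointSet.ext hZY
    exact not_r_of_ssubset hX' (r_trans hXZ h')
  · exact E.e2_bc X Y ⟨⟨X', hX', r_symm h'⟩, Z, hZ.ssubset_of_ne hZY, hXZ⟩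

theorem Dominated.antisymm {X Y : PointSet} (h : E.Dominated X Y) (h' : E.Dominated Y X) :
    E.r X Y := by
  obtain ⟨Z, hZ, hYZ⟩ := h'
  by_cases hZX : Z.carrier = X.carrier
  · obtain rfl : Z = X := PointSet.ext hZX
    exact r_symm hYZ
  · exact (h.not_r_ssubset (hZ.ssubset_of_ne hZX) hYZ).elim

theorem Dominated.trans_r {X Y Y' : PointSet} (h : E.Dominated X Y) (h' : E.r Y Y') :
    E.Dominated X Y' := by
  obtain ⟨Z, hZ, hXZ⟩ := h
  by_cases hZY : Z.carrier = Y.carrier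
  · obtain rfl : Z = Y := PointSet.ext hZY
    exact ⟨Y', subset_rfl, r_trans hXZ h'⟩
  · obtain ⟨W, hW, h⟩ := exists_ssubset h' (hZ.ssubset_of_ne hZY)
    exact ⟨W, hW.1, r_trans hXZ h⟩

/-- Multiplying by the singleton of `[m]` preserves numerosities by (E3) and annihilates all counts
below `m`, so (E0) needs its inequality only from `m` on. -/
theorem IsAsymptotic.dominated (hE : E.IsAsymptotic) {X Y : PointSet}
    (h : ∀ᶠ n in atTop, X.count n ≤ Y.count n) : E.Dominated X Y := by
  obtain ⟨m, hm⟩ := eventually_atTop.1 h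
  have hm' : [m] ≠ [] := List.cons_ne_nil _ _
  have key : E.Dominated ((PointSet.singleton [m] hm').prod X)
      ((PointSet.singleton [m] hm').prod Y) := by
    refine hE _ _ fun n => ?_
    rw [PointSet.count_prod, PointSet.count_prod, PointSet.count_singleton]
    split_ifs with hn
    · exact Nat.mul_le_mul_left _ (hm n (by simpa [PointSet.height] using hn))
    · simp
  obtain ⟨Z, hZ, h⟩ := key.trans_r (E.e3_left Y [m] hm')
  exact ⟨Z, hZ, r_trans (r_symm (E.e3_left X [m] hm')) h⟩

end Equinumerosity

/-! ### Disjoint sums -/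

namespace PointSet

/-- The dimension of a point set (an arbitrary positive number for the empty point set). -/
noncomputable def dim (X : PointSet) : ℕ := X.homogeneous.choose

theorem length_eq_dim {X : PointSet} {x : List ℕ} (hx : x ∈ X.carrier) : x.length = X.dim :=
  X.homogeneous.choose_spec.2 x hx

/-- A copy of `X` with first coordinate `0`. -/
noncomputable def inl (X Y : PointSet) : PointSet :=
  (singleton (0 :: List.replicate Y.dim 0) (List.cons_ne_nil _ _)).prod X

/-- A copy of `Y` with first coordinate `1`. -/
noncomputable def inr (X Y : PointSet) : PointSet :=
  (singleton (1 :: List.replicate X.dim 0) (List.cons_ne_nil _ _)).prod Y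

theorem disjoint_inl_inr (X Y : PointSet) : Disjoint (inl X Y).carrier (inr X Y).carrier := by
  refine Set.disjoint_left.2 fun x hx hx' => ?_
  obtain ⟨a, _, rfl⟩ := Equinumerosity.mem_lift.1 hx
  obtain ⟨b, _, h⟩ := Equinumerosity.mem_lift.1 hx'
  simp at h

/-- A disjoint union of copies of `X` and `Y`. -/
noncomputable def dsum (X Y : PointSet) : PointSet where
  carrier := (inl X Y).carrier ∪ (inr X Y).carrier
  homogeneous := by
    refine ⟨X.dim + Y.dim + 1, Nat.succ_pos _, ?_⟩
    rintro x (hx | hx)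
    · obtain ⟨a, ha, rfl⟩ := Equinumerosity.mem_lift.1 hx
      simp [length_eq_dim ha]
      omega
    · obtain ⟨a, ha, rfl⟩ := Equinumerosity.mem_lift.1 hx
      simp [length_eq_dim ha]

theorem eventually_count_dsum (X Y : PointSet) :
    ∀ᶠ n in atTop, (dsum X Y).count n = X.count n + Y.count n := by
  filter_upwards [eventually_count_singleton (List.cons_ne_nil 0 (List.replicate Y.dim 0)),
    eventually_count_singleton (List.cons_ne_nil 1 (List.replicate X.dim 0))] with n h1 h2
  rw [count_union (disjoint_inl_inr X Y) rfl, inl, inr, count_prod, count_prod, h1, h2, one_mul,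
    one_mul]

end PointSet

/-! ### The ultrafilter of an asymptotic equinumerosity -/

namespace Equinumerosity

open PointSet

variable {E : Equinumerosity}

theorem r_inl (X Y : PointSet) : E.r (inl X Y) X := E.e3_left _ _ _

theorem r_inr (X Y : PointSet) : E.r (inr X Y) Y := E.e3_left _ _ _

theorem r_dsum {X X' Y Y' : PointSet} (hX : E.r X X') (hY : E.r Y Y') :
    E.r (dsum X Y) (dsum X' Y') :=
  sum_congr (disjoint_inl_inr X Y) rfl (disjoint_inl_inr X' Y') rfl
    (r_trans (r_inl X Y) (r_trans hX (r_symm (r_inl X' Y'))))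
    (r_trans (r_inr X Y) (r_trans hY (r_symm (r_inr X' Y'))))

theorem exists_ssubset_dsum {X X' : PointSet} (Y : PointSet) (h : X'.carrier ⊂ X.carrier) :
    ∃ D : PointSet, D.carrier ⊂ (dsum X Y).carrier ∧ E.r (dsum X' Y) D := by
  obtain ⟨A, hA, hA'⟩ := exists_ssubset (r_symm (r_inl (E := E) X Y)) h
  refine ⟨(dsum X Y).restrict (A.carrier ∪ (inr X Y).carrier) (Set.union_subset_union_left _ hA.1),
    ?_, ?_⟩
  · refine Set.ssubset_iff_subset_ne.2 ⟨Set.union_subset_union_left _ hA.1, fun he => ?_⟩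
    obtain ⟨p, hp, hp'⟩ := Set.exists_of_ssubset hA
    have : p ∈ A.carrier ∪ (inr X Y).carrier :=
      (show A.carrier ∪ (inr X Y).carrier = (inl X Y).carrier ∪ (inr X Y).carrier from he) ▸
        Or.inl hp
    exact this.elim hp' fun h => Set.disjoint_left.1 (disjoint_inl_inr X Y) hp h
  · exact sum_congr (disjoint_inl_inr X' Y) rfl ((disjoint_inl_inr X Y).mono_left hA.1) rfl
      (r_trans (r_inl X' Y) hA') (r_trans (r_inr X' Y) (r_symm (r_inr X Y)))

/-- Equinumerous summands cancel: if `Y` were equinumerous to a proper subset of `X`, then `Y + W`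
would be equinumerous to a proper subset of `X + V`, which it dominates. -/
theorem IsAsymptotic.dominated_of_add (hE : E.IsAsymptotic) {X Y V W : PointSet} (hVW : E.r V W)
    (h : ∀ᶠ n in atTop, X.count n + V.count n ≤ Y.count n + W.count n) : E.Dominated X Y := by
  rcases E.e2_exists X Y with h1 | ⟨X', hX', h1⟩ | ⟨Y', hY', h1⟩
  · exact ⟨Y, subset_rfl, h1⟩
  · have key : E.Dominated (dsum X V) (dsum Y W) := by
      refine hE.dominated ?_
      filter_upwards [h, eventually_count_dsum X V, eventually_count_dsum Y W] with n h1 h2 h3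
      omega
    obtain ⟨D, hD, hD'⟩ := exists_ssubset_dsum (E := E) V hX'
    exact (key.not_r_ssubset hD (r_trans (r_dsum (r_symm h1) (r_symm hVW)) hD')).elim
  · exact ⟨Y', hY'.1, h1⟩

/-- A point set whose counting function is eventually `|X_n| ^ 2 + |Y_n| ^ 2`. -/
noncomputable def sumSq (X Y : PointSet) : PointSet := dsum (X.prod X) (Y.prod Y)

/-- A point set whose counting function is eventually `2 * |X_n| * |Y_n|`. -/
noncomputable def twoMul (X Y : PointSet) : PointSet := dsum (X.prod Y) (X.prod Y)

theorem r_twoMul_sumSq {X Y : PointSet} (h : E.r X Y) : E.r (twoMul X Y) (sumSq X Y) :=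
  r_dsum (E.e4 _ _ _ _ (r_refl X) (r_symm h)) (E.e4 _ _ _ _ h (r_refl Y))

theorem eventually_count_sumSq (X Y : PointSet) : ∀ᶠ n in atTop,
    (sumSq X Y).count n = X.count n * X.count n + Y.count n * Y.count n := by
  filter_upwards [eventually_count_dsum (X.prod X) (Y.prod Y)] with n h
  rw [sumSq, h, count_prod, count_prod]

theorem eventually_count_twoMul (X Y : PointSet) : ∀ᶠ n in atTop,
    (twoMul X Y).count n = X.count n * Y.count n + X.count n * Y.count n := by
  filter_upwards [eventually_count_dsum (X.prod Y) (X.prod Y)] with n h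
  rw [twoMul, h, count_prod]

theorem not_r_singleton_empty {P : List ℕ} (hP : P ≠ []) : ¬ E.r (singleton P hP) empty :=
  not_r_of_ssubset (Set.empty_ssubset.2 (Set.singleton_nonempty P))

/-- The filter generated by the sets `{n | |X_n| = |Y_n|}`, for equinumerous `X` and `Y`, and the
cofinite sets. -/
def toFilter (E : Equinumerosity) : Filter ℕ where
  sets := {S | ∃ X Y : PointSet, E.r X Y ∧ ∀ᶠ n in atTop, X.count n = Y.count n → n ∈ S}
  univ_sets := ⟨empty, empty, r_refl _, .of_forall fun _ _ => trivial⟩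
  sets_of_superset := by
    rintro S T ⟨X, Y, h, hS⟩ hST
    exact ⟨X, Y, h, hS.mono fun n hn hXY => hST (hn hXY)⟩
  inter_sets := by
    rintro S T ⟨X, Y, h, hS⟩ ⟨V, W, h', hT⟩
    -- The two sums are equinumerous, and their counts eventually differ by `(|X_n| - |Y_n|) ^ 2 +
    -- (|V_n| - |W_n|) ^ 2`, which vanishes only if both equations hold.
    refine ⟨_, _, r_dsum (r_twoMul_sumSq h) (r_twoMul_sumSq h'), ?_⟩
    filter_upwards [hS, hT, eventually_count_sumSq X Y, eventually_count_twoMul X Y,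
      eventually_count_sumSq V W, eventually_count_twoMul V W,
      eventually_count_dsum (twoMul X Y) (twoMul V W),
      eventually_count_dsum (sumSq X Y) (sumSq V W)] with n h1 h2 h3 h4 h5 h6 h7 h8 heq
    rw [h7, h8, h3, h4, h5, h6] at heq
    zify at heq h1 h2
    have key : ((X.count n : ℤ) - Y.count n) ^ 2 + ((V.count n : ℤ) - W.count n) ^ 2 = 0 := by
      linear_combination -heq
    have k1 : ((X.count n : ℤ) - Y.count n) ^ 2 = 0 := by
      nlinarith [sq_nonneg ((X.count n : ℤ) - Y.count n), sq_nonneg ((V.count n : ℤ) - W.count n)]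
    have k2 : ((V.count n : ℤ) - W.count n) ^ 2 = 0 := by rwa [k1, zero_add] at key
    exact ⟨h1 (sub_eq_zero.1 (pow_eq_zero_iff two_ne_zero |>.1 k1)),
      h2 (sub_eq_zero.1 (pow_eq_zero_iff two_ne_zero |>.1 k2))⟩

theorem toFilter_le_atTop : E.toFilter ≤ atTop := fun _ hS =>
  ⟨empty, empty, r_refl _, Eventually.mono hS fun _ hn _ => hn⟩

/-- If `|X_n| ≠ |Y_n|` eventually, then `2 |X_n| |Y_n| + 1 ≤ |X_n| ^ 2 + |Y_n| ^ 2`; cancelling the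
equinumerous sides would make a singleton dominated by the empty set. -/
theorem IsAsymptotic.empty_notMem (hE : E.IsAsymptotic) : ∅ ∉ E.toFilter := by
  rintro ⟨X, Y, h, hS⟩
  have hP : [0] ≠ [] := List.cons_ne_nil _ _
  have key : E.Dominated (singleton [0] hP) empty := by
    refine hE.dominated_of_add (r_twoMul_sumSq h) ?_
    filter_upwards [hS, eventually_count_sumSq X Y, eventually_count_twoMul X Y,
      eventually_count_singleton hP] with n h1 h2 h3 h4
    rw [h2, h3, h4, count_empty]
    rcases lt_or_gt_of_ne fun hn => (h1 hn).elim with h5 | h5 <;> nlinarith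
  obtain ⟨Z, hZ, h⟩ := key
  obtain rfl : Z = empty := PointSet.ext (Set.subset_empty_iff.1 hZ)
  exact not_r_singleton_empty hP h

theorem IsAsymptotic.r_iff (hE : E.IsAsymptotic) (X Y : PointSet) :
    E.r X Y ↔ {n | X.count n = Y.count n} ∈ E.toFilter := by
  have key : ∀ X Y : PointSet, {n | X.count n = Y.count n} ∈ E.toFilter → E.Dominated X Y := by
    rintro X Y ⟨V, W, h, hS⟩
    -- Where `|V_n| ≠ |W_n|`, the sum of squares exceeds the double product by at least one. The
    -- factor `|X_n| + |Y_n|` turns this surplus into at least `|X_n|`, so the inequality also holds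
    -- where nothing is known about `X` and `Y`.
    refine hE.dominated_of_add
      (E.e4 _ _ _ _ (r_refl (dsum X Y)) (r_twoMul_sumSq h)) ?_
    filter_upwards [hS, eventually_count_dsum X Y, eventually_count_sumSq V W,
      eventually_count_twoMul V W] with n h1 h2 h3 h4
    rw [count_prod, count_prod, h2, h3, h4]
    by_cases h5 : V.count n = W.count n
    · rw [show X.count n = Y.count n from h1 h5, h5]
    · have h6 : V.count n * W.count n + V.count n * W.count n + 1 ≤
          V.count n * V.count n + W.count n * W.count n := by
        rcases lt_or_gt_of_ne h5 with h5 | h5 <;> nlinarith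
      have h7 := Nat.mul_le_mul_left (X.count n + Y.count n) h6
      rw [mul_add, mul_one] at h7
      omega
  refine ⟨fun h => ⟨X, Y, h, .of_forall fun _ => id⟩, fun h => (key X Y h).antisymm (key Y X ?_)⟩
  simpa only [eq_comm] using h

/-- The order is discrete: a proper subset of `Y` equinumerous to `X` leaves a point of `Y` free to
serve as the extra singleton. -/
theorem Dominated.dsum_singleton {X Y : PointSet} {P : List ℕ} (hP : P ≠ [])
    (h : E.Dominated X Y) (hXY : ¬ E.r X Y) : E.Dominated (dsum X (singleton P hP)) Y := by
  obtain ⟨Z, hZ, hXZ⟩ := h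
  obtain ⟨p, hp, hpZ⟩ := Set.exists_of_ssubset (hZ.ssubset_of_ne fun h => hXY (by
    rwa [← show Z = Y from PointSet.ext h]))
  have hp' : p ≠ [] := by
    obtain ⟨k, hk, h⟩ := Y.homogeneous
    exact List.length_pos_iff.1 ((h p hp).symm ▸ hk)
  have hsub : Z.carrier ∪ {p} ⊆ Y.carrier := Set.union_subset hZ (Set.singleton_subset_iff.2 hp)
  refine ⟨Y.restrict _ hsub, hsub, sum_congr (B' := singleton p hp') (disjoint_inl_inr _ _) rfl
    (Set.disjoint_singleton_right.2 hpZ) rfl (r_trans (r_inl _ _) hXZ) (r_trans (r_inr _ _) ?_)⟩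
  -- Any two singletons are equinumerous to their common product, by the two halves of (E3).
  exact r_trans (r_symm (E.e3_right (singleton P hP) p hp')) (E.e3_left (singleton p hp') P hP)

/-- Every set of indices is, up to a finite set, of the form `{n | |X_n| = |Y_n|}`. -/
theorem exists_count_eq_or_succ (S : Set ℕ) : ∃ X Y : PointSet, ∀ᶠ n in atTop,
    (n ∈ S → X.count n = Y.count n) ∧ (n ∉ S → X.count n = Y.count n + 1) := by
  classical
  -- The value `min 1 n` replaces `1` to respect the bound by `n` at `n = 0`.
  obtain ⟨X, hX⟩ := exists_count_eq_add_sq (fun n => if n ∈ S then 0 else min 1 n)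
    fun n => by split_ifs <;> simp
  obtain ⟨Y, hY⟩ := exists_count_eq_add_sq (fun _ => 0) fun n => Nat.zero_le n
  refine ⟨X, Y, ?_⟩
  filter_upwards [eventually_ge_atTop 1] with n hn
  rw [hX, hY]
  constructor
  · intro h
    simp [h]
  · intro h
    simp only [if_neg h, min_eq_left hn]
    omega

/-- Take `X` and `Y` whose counts eventually differ by the indicator of the complement of `S`. Then
`Y ≤ X ≤ Y + 1`, and discreteness leaves `X ≈ Y`, which puts `S` in the filter, or `X ≈ Y + 1`,
which puts its complement there. -/
theorem IsAsymptotic.mem_or_compl_mem (hE : E.IsAsymptotic) (S : Set ℕ) :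
    S ∈ E.toFilter ∨ Sᶜ ∈ E.toFilter := by
  obtain ⟨X, Y, h⟩ := exists_count_eq_or_succ S
  by_cases hXY : E.r Y X
  · refine Or.inl ⟨Y, X, hXY, h.mono fun n hn heq => ?_⟩
    by_contra hS
    have := hn.2 hS
    omega
  · have hP : [0] ≠ [] := List.cons_ne_nil _ _
    have hYX : E.Dominated Y X := hE.dominated (h.mono fun n hn => by
      by_cases hS : n ∈ S
      · exact (hn.1 hS).ge
      · rw [hn.2 hS]
        exact Nat.le_succ _)
    have hcount := (eventually_count_dsum Y (singleton [0] hP)).and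
      (eventually_count_singleton hP)
    have h2 : E.Dominated X (dsum Y (singleton [0] hP)) := hE.dominated (by
      filter_upwards [h, hcount] with n hn hc
      rw [hc.1, hc.2]
      by_cases hS : n ∈ S
      · rw [hn.1 hS]
        exact Nat.le_succ _
      · exact (hn.2 hS).le)
    refine Or.inr ⟨X, _, h2.antisymm (hYX.dsum_singleton hP hXY), ?_⟩
    filter_upwards [h, hcount] with n hn hc heq hS
    rw [hc.1, hc.2, hn.1 hS] at heq
    omega

/-- The ultrafilter of an asymptotic equinumerosity. -/
def IsAsymptotic.ultrafilter (hE : E.IsAsymptotic) : Ultrafilter ℕ :=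
  Ultrafilter.ofComplNotMemIff E.toFilter fun S => by
    constructor
    · exact (hE.mem_or_compl_mem S).resolve_right
    · intro h h'
      exact hE.empty_notMem (by simpa using inter_mem h h')

theorem IsAsymptotic.r_iff_ultrafilter (hE : E.IsAsymptotic) (X Y : PointSet) :
    E.r X Y ↔ {n | X.count n = Y.count n} ∈ hE.ultrafilter := hE.r_iff X Y

/-- Realize `f n + n ^ 2` by `X` and `n ^ 2` by `Y`. By (E0), `Y` is equinumerous to some `Z ⊆ X`,
and the count of the difference of `X` and `Z`, nondecreasing like every count, equals `f` wherever
`|Y_n| = |Z_n|`. -/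
theorem IsAsymptotic.quasiSelective (hE : E.IsAsymptotic) : QuasiSelective hE.ultrafilter := by
  constructor
  · intro m hm
    have h1 : {n | m < n} ∈ hE.ultrafilter := toFilter_le_atTop (eventually_gt_atTop m)
    rw [hm] at h1
    exact lt_irrefl m h1
  · intro f hf
    obtain ⟨X, hX⟩ := exists_count_eq_add_sq f hf
    obtain ⟨Y, hY⟩ := exists_count_eq_add_sq (fun _ => 0) fun n => Nat.zero_le n
    obtain ⟨Z, hZ, hYZ⟩ := hE Y X fun n => by rw [hX, hY]; omega
    refine ⟨(X.diff Z).count, count_mono _, ?_⟩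
    filter_upwards [(hE.r_iff_ultrafilter _ _).1 hYZ] with n hn
    have hn : Y.count n = Z.count n := hn
    have h1 := count_union (A := Z) (B := X.diff Z) (C := X) Set.disjoint_sdiff_right
      (Set.union_sdiff_cancel hZ).symm n
    show f n = (X.diff Z).count n
    rw [hX, ← hn, hY] at h1
    omega

end Equinumerosity

/-! ### Numerosities as germs, and the correspondence -/

theorem isLowerSet_polynomialPart (U : Ultrafilter ℕ) :
    IsLowerSet (polynomialPart U : Set ((U : Filter ℕ).Germ ℕ)) := by
  rintro _ y hy ⟨f, hf, rfl⟩
  induction y using Germ.inductionOn with | _ g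
  have hy : ∀ᶠ n in (U : Filter ℕ), g n ≤ f n := hy
  exact ⟨fun n => min (g n) (f n), hf.mono fun n => min_le_right _ _,
    Germ.coe_eq.2 (hy.mono fun n hn => (min_eq_left hn).symm)⟩

theorem QuasiSelective.exists_count_eq {U : Ultrafilter ℕ} (hU : QuasiSelective U) {f : ℕ → ℕ}
    (hf : PolynomiallyBounded f) :
    ∃ X : PointSet, ∀ᶠ n in (U : Filter ℕ), X.count n = f n := by
  obtain ⟨k, m, h⟩ := hf
  -- Dimension `k + 1` rather than `k`, because dimensions must be positive.
  obtain ⟨X, -, hX⟩ := hU.exists_subset_count_eq (PointSet.full (k + 1) k.succ_pos) f (by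
    filter_upwards [hU.le_atTop (eventually_gt_atTop m)] with n hn
    rw [PointSet.count_full]
    exact (h n hn).le.trans ((Nat.pow_le_pow_left n.le_succ k).trans
      (Nat.pow_le_pow_right n.succ_pos k.le_succ)))
  exact ⟨X, hX⟩

/-- Two ultrafilters giving the same relation on point sets are equal. -/
theorem QuasiSelective.eq_of_count_iff {U V : Ultrafilter ℕ} (hU : QuasiSelective U)
    (hV : QuasiSelective V)
    (h : ∀ X Y : PointSet, {n | X.count n = Y.count n} ∈ U ↔ {n | X.count n = Y.count n} ∈ V) :
    U = V := by
  ext S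
  obtain ⟨X, Y, hXY⟩ := Equinumerosity.exists_count_eq_or_succ S
  have key : ∀ᶠ n in atTop, X.count n = Y.count n ↔ n ∈ S := by
    filter_upwards [hXY] with n hn
    refine ⟨fun heq => ?_, hn.1⟩
    by_contra hS
    have := hn.2 hS
    omega
  exact (eventually_congr (hU.le_atTop key)).symm.trans
    ((h X Y).trans (eventually_congr (hV.le_atTop key)))

namespace Equinumerosity

open PointSet

variable {E : Equinumerosity} {U : Ultrafilter ℕ}

/-- The class modulo `U` of the counting function. -/
noncomputable def germ (hEU : ∀ X Y : PointSet, E.r X Y ↔ {n : ℕ | X.count n = Y.count n} ∈ U)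
    (x : E.Numerosity) : polynomialPart U :=
  Quotient.lift (fun X : PointSet => (⟨((X.count : ℕ → ℕ) : (U : Filter ℕ).Germ ℕ),
      X.count, X.polynomiallyBounded_count, rfl⟩ : polynomialPart U))
    (fun X Y h => Subtype.ext (Germ.coe_eq.2 ((hEU X Y).1 h))) x

theorem coe_germ_num (hEU : ∀ X Y : PointSet, E.r X Y ↔ {n : ℕ | X.count n = Y.count n} ∈ U)
    (X : PointSet) :
    (germ hEU (E.num X) : (U : Filter ℕ).Germ ℕ) = ((X.count : ℕ → ℕ) : (U : Filter ℕ).Germ ℕ) :=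
  rfl

theorem germ_bijective (hU : QuasiSelective U)
    (hEU : ∀ X Y : PointSet, E.r X Y ↔ {n : ℕ | X.count n = Y.count n} ∈ U) :
    Function.Bijective (germ hEU) := by
  constructor
  · intro x y hxy
    induction x using Quotient.inductionOn with | _ X
    induction y using Quotient.inductionOn with | _ Y
    exact num_eq_num.2 ((hEU X Y).2 (Germ.coe_eq.1 (congrArg Subtype.val hxy)))
  · rintro ⟨_, f, hf, rfl⟩
    obtain ⟨X, hX⟩ := hU.exists_count_eq hf
    exact ⟨E.num X, Subtype.ext (Germ.coe_eq.2 hX)⟩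

theorem germ_add (hEU : ∀ X Y : PointSet, E.r X Y ↔ {n : ℕ | X.count n = Y.count n} ∈ U)
    (x y : E.Numerosity) : germ hEU (x + y) = germ hEU x + germ hEU y := by
  obtain ⟨z, ⟨A, B, C, hd, hC, rfl, rfl, rfl⟩, -⟩ := existsUnique_isSum x y
  rw [num_add_num hd hC]
  exact Subtype.ext (Germ.coe_eq.2 (.of_forall fun n => count_union hd hC n))

theorem germ_mul (hEU : ∀ X Y : PointSet, E.r X Y ↔ {n : ℕ | X.count n = Y.count n} ∈ U)
    (x y : E.Numerosity) : germ hEU (x * y) = germ hEU x * germ hEU y := by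
  induction x using Quotient.inductionOn with | _ X
  induction y using Quotient.inductionOn with | _ Y
  exact Subtype.ext (Germ.coe_eq.2 (.of_forall fun n => count_prod X Y n))

theorem germ_lt_germ (hU : QuasiSelective U)
    (hEU : ∀ X Y : PointSet, E.r X Y ↔ {n : ℕ | X.count n = Y.count n} ∈ U)
    {x y : E.Numerosity} : germ hEU x < germ hEU y ↔ x < y := by
  induction x using Quotient.inductionOn with | _ X
  induction y using Quotient.inductionOn with | _ Y
  have h1 : germ hEU (E.num X) < germ hEU (E.num Y) ↔
      ∀ᶠ n in (U : Filter ℕ), X.count n < Y.count n := by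
    rw [← Subtype.coe_lt_coe, coe_germ_num, coe_germ_num, Germ.coe_lt]
  refine h1.trans ?_
  rw [← hU.exists_ssubset_count_eq_iff X Y]
  exact exists_congr fun B' => and_congr_right fun _ => (hEU X B').symm

theorem exists_orderRingIso (hU : QuasiSelective U)
    (hEU : ∀ X Y : PointSet, E.r X Y ↔ {n : ℕ | X.count n = Y.count n} ∈ U) :
    ∃ φ : E.Numerosity ≃+*o polynomialPart U,
      (∀ X : PointSet, (φ (E.num X) : (U : Filter ℕ).Germ ℕ) =
        ((fun n : ℕ => X.count n : ℕ → ℕ) : (U : Filter ℕ).Germ ℕ)) ∧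
      φ 0 = 0 ∧ φ 1 = 1 ∧ ∀ x y : E.Numerosity, φ x < φ y ↔ x < y := by
  have hb := germ_bijective hU hEU
  refine ⟨{ Equiv.ofBijective (germ hEU) hb with
    map_mul' := germ_mul hEU
    map_add' := germ_add hEU
    map_le_map_iff' := fun {x y} => ?_ }, fun X => rfl, ?_, ?_, fun x y => germ_lt_germ hU hEU⟩
  · show germ hEU x ≤ germ hEU y ↔ (x < y ∨ x = y)
    rw [le_iff_lt_or_eq, germ_lt_germ hU hEU, hb.1.eq_iff]
  · exact Subtype.ext (Germ.coe_eq.2 (.of_forall count_empty))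
  · exact Subtype.ext (Germ.coe_eq.2 (hU.le_atTop (eventually_count_singleton _)))

/-- The correspondence between asymptotic equinumerosities and quasi-selective ultrafilters. -/
def correspondence :
    {E : Equinumerosity // E.IsAsymptotic} ≃ {U : Ultrafilter ℕ // QuasiSelective U} where
  toFun E := ⟨E.2.ultrafilter, E.2.quasiSelective⟩
  invFun U := ⟨U.2.equinumerosity, U.2.isAsymptotic_equinumerosity⟩
  left_inv E := by
    refine Subtype.ext (Equinumerosity.ext ?_)
    funext X Y
    exact propext (E.2.r_iff_ultrafilter X Y).symm
  -- Both ultrafilters induce the same relation, and the relation determines the ultrafilter because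
  -- every set of indices is, up to a finite set, the coincidence set of two counts.
  right_inv U := Subtype.ext (QuasiSelective.eq_of_count_iff
    U.2.isAsymptotic_equinumerosity.quasiSelective U.2 fun X Y =>
      (U.2.isAsymptotic_equinumerosity.r_iff_ultrafilter X Y).symm)

end Equinumerosity

theorem mainTheorem1 :
    -- the one-to-one correspondence, which is the only one with the stated property
    (∃! Θ : {E : Equinumerosity // E.IsAsymptotic} ≃ {U : Ultrafilter ℕ // QuasiSelective U},
      ∀ (E : {E : Equinumerosity // E.IsAsymptotic}) (X Y : PointSet),
        E.1.r X Y ↔ {n : ℕ | X.count n = Y.count n} ∈ (Θ E).1) ∧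
    -- the isomorphism of ordered semirings, for corresponding `E` and `U`
    (∀ (E : Equinumerosity) (U : Ultrafilter ℕ), E.IsAsymptotic → QuasiSelective U →
      (∀ X Y : PointSet, E.r X Y ↔ {n : ℕ | X.count n = Y.count n} ∈ U) →
      IsLowerSet (polynomialPart U : Set ((U : Filter ℕ).Germ ℕ)) ∧
      ∃ φ : E.Numerosity ≃+*o polynomialPart U,
        (∀ X : PointSet, (φ (E.num X) : (U : Filter ℕ).Germ ℕ) =
          ((fun n : ℕ => X.count n : ℕ → ℕ) : (U : Filter ℕ).Germ ℕ)) ∧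
        φ 0 = 0 ∧ φ 1 = 1 ∧ ∀ x y : E.Numerosity, φ x < φ y ↔ x < y) ∧
    -- existence
    ((∃ E : Equinumerosity, E.IsAsymptotic) ↔ ∃ U : Ultrafilter ℕ, QuasiSelective U) := by
  refine ⟨⟨Equinumerosity.correspondence, fun E X Y => E.2.r_iff_ultrafilter X Y,
    fun Θ hΘ => ?_⟩, fun E U _ hU hEU => ⟨isLowerSet_polynomialPart U,
      Equinumerosity.exists_orderRingIso hU hEU⟩, ?_⟩
  · refine Equiv.ext fun E => Subtype.ext (QuasiSelective.eq_of_count_iff (Θ E).2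
      E.2.quasiSelective fun X Y => ?_)
    exact (hΘ E X Y).symm.trans (E.2.r_iff_ultrafilter X Y)
  · exact ⟨fun ⟨_, hE⟩ => ⟨_, hE.quasiSelective⟩,
      fun ⟨_, hU⟩ => ⟨_, hU.isAsymptotic_equinumerosity⟩⟩
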